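/- Let $\{X_t\}_{t\in\mathbb Z}$ be a stationary process, defined on a probability space $(\Omega,\mathcal F,P)$, with values in a Polish space $\mathcal X$ (with its Borel $\sigma$-field); put $X=X_0$ and $X^-=(\dots,X_{-2},X_{-1})$. Let $\{\mathcal B_k\}_{k\ge1}$ be an increasing sequence of finite subfields of the Borel $\sigma$-field of $\mathcal X$ whose union generates the Borel $\sigma$-field, and let $[x]^k$ denote the atom of $\mathcal B_k$ that contains $x$. Let $\{\ell_k\}_{k\ge1}$ and $\{J_k\}_{k\ge1}$ be nondecreasing unbounded sequences of positive integers. For each $k$ let $\tau^k_0=0$ and, for $j\ge1$, $$\tau^k_j=\min\{t>\tau^k_{j-1}:\ ([X_{-\ell_k-t}]^k,\dots,[X_{-1-t}]^k)=([X_{-\ell_k}]^k,\dots,[X_{-1}]^k)\}$$ be the successive past recurrence times of the pattern $[X^{-\ell_k}]^k=([X_{-\ell_k}]^k,\dots,[X_{-1}]^k)$. Put $\lambda_k=\ell_k+\tau^k_{J_k}$, $X^{-\lambda_k}=(X_{-\lambda_k},\dots,X_{-1})$, and for Borel sets $B\subseteq\mathcal X$ define $$\hat P_k\{X\in B\mid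 X^{-\lambda_k}\}=\frac1{J_k}\sum_{1\le j\le J_k}1\{X_{-\tau^k_j}\in B\},$$ the empirical distribution of the values that followed the last $J_k$ occurrences of the pattern $[X^{-\ell_k}]^k$. Then, almost surely, all $\tau^k_j$ ($k\ge1$, $j\ge0$) are finite (that is, each minimum is taken over a nonempty set), and for every set $B$ in the generating field $\bigcup_k\mathcal B_k$, $$\lim_{k\to\infty}\hat P_k\{X\in B\mid X^{-\lambda_k}\}=P\{X\in B\mid X^-\}\quad\text{in }L^1(P).$$ -/

import Mathlib

open MeasureTheory ProbabilityTheory Filter Topology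
open scoped ENNReal

/-- A two-sided process is stationary if its law on the sequence space is shift invariant. -/
def IsStationaryProcess {Ω S : Type*} [MeasurableSpace Ω] [MeasurableSpace S]
    (X : ℤ → Ω → S) (μ : Measure Ω) : Prop :=
  ∀ n : ℤ, μ.map (fun ω (t : ℤ) => X (t + n) ω) = μ.map (fun ω (t : ℤ) => X t ω)

/-- An increasing sequence of finite subfields of `S` which generate the σ-field of `S`.
A finite field is the same thing as a σ-field with finitely many members. -/
structure IsFiniteGeneratingSequence {S : Type*} [mS : MeasurableSpace S]
    (𝓑 : ℕ → MeasurableSpace S) : Prop where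
  mono : Monotone 𝓑
  finite : ∀ k, {B : Set S | MeasurableSet[𝓑 k] B}.Finite
  generates : ⨆ k, 𝓑 k = mS

/-- The quantizer `x ↦ [x]` of a finite field `𝓕`: the atom of `𝓕` that contains `x`. -/
def quantize {S : Type*} (𝓕 : MeasurableSpace S) (x : S) : Set S :=
  @measurableAtom S 𝓕 x

/-- The quantized block `([X_{-ℓ-t}], …, [X_{-1-t}])` of length `ℓ`, seen `t` steps back. -/
def quantizedPast {Ω S : Type*} (𝓕 : MeasurableSpace S) (X : ℤ → Ω → S) (ℓ : ℕ) (ω : Ω)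
    (t : ℕ) : Fin ℓ → Set S :=
  fun i => quantize 𝓕 (X (-(ℓ : ℤ) - t + (i : ℕ)) ω)

/-- The times `t > s` at which the quantized `ℓ`-past seen `t` steps back
equals the quantized `ℓ`-past at time `0`. -/
def recurrenceSet {Ω S : Type*} (𝓕 : MeasurableSpace S) (X : ℤ → Ω → S) (ℓ : ℕ) (ω : Ω)
    (s : ℕ) : Set ℕ :=
  {t | s < t ∧ quantizedPast 𝓕 X ℓ ω t = quantizedPast 𝓕 X ℓ ω 0}

/-- The past recurrence times `τ_0 = 0`, `τ_{j+1} = min {t > τ_j : the pattern recurs at t}`.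
(The infimum is a minimum whenever the recurrence set is nonempty.) -/
noncomputable def recurrenceTime {Ω S : Type*} (𝓕 : MeasurableSpace S) (X : ℤ → Ω → S) (ℓ : ℕ)
    (ω : Ω) : ℕ → ℕ
  | 0 => 0
  | j + 1 => sInf (recurrenceSet 𝓕 X ℓ ω (recurrenceTime 𝓕 X ℓ ω j))

/-- The empirical distribution `(1/J) ∑_{1 ≤ j ≤ J} δ_{X_{-τ_j}}` of the values that followed
the last `J` occurrences of the quantized `ℓ`-past. -/
noncomputable def empiricalConditional {Ω S : Type*} (𝓕 : MeasurableSpace S)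
    [mS : MeasurableSpace S] (X : ℤ → Ω → S) (ℓ J : ℕ) (ω : Ω) : @Measure S mS :=
  (J : ℝ≥0∞)⁻¹ • ∑ j ∈ Finset.Icc 1 J,
    @Measure.dirac S mS (X (-(recurrenceTime 𝓕 X ℓ ω j : ℤ)) ω)

/-- The σ-field generated by the infinite past `X^- = (…, X_{-2}, X_{-1})`. -/
@[reducible] def pastSigma {Ω S : Type*} [mS : MeasurableSpace S] (X : ℤ → Ω → S) : MeasurableSpace Ω :=
  ⨆ (t : ℤ) (_ : t < 0), mS.comap (X t)

/-! Carry the law of the process to the space of two-sided sequences, where `pastShift` moves the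
origin one step back. For the pattern map q, let R send a sequence to its first shift with the same
pattern. By Poincaré recurrence almost every point returns; R preserves the law
(`measurePreserving_returnMap`), and shifting by the j-th recurrence time is R^j
(`iterate_pastShift_recurrenceTime`). The estimate is therefore the average of f ∘ R^j over 1 ≤ j ≤
J, with f the indicator that the present value lies in B.

Let h = E[f | past] and g = E[f | q]. The return time is positive and determined by the past, so R
pulls present events back to past events. Hence the terms (f - h) ∘ R^j are orthogonal, and their
average has L¹ norm of order J^(-1/2) (`integral_birkhoffSum_sq`). Since g ∘ R = g and R preserves
the law, replacing the average of h ∘ R^j by h costs at most 2 E|g - h|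
(`integral_abs_average_returnMap_sub_le`). This vanishes in the limit by Lévy's upward theorem,
because the pattern σ-fields increase to the past (`iSup_patternFiltration`). -/

/-! ### Return maps to the fibres of a countably valued function. -/

section ReturnMap

variable {Y W : Type*}

/-- The set of points whose first return to their own `q`-fibre under `S` happens at time `n`. -/
def firstReturnSet (S : Y → Y) (q : Y → W) (n : ℕ) : Set Y :=
  {y | 0 < n ∧ q (S^[n] y) = q y ∧ ∀ m, 0 < m → m < n → q (S^[m] y) ≠ q y}

/-- The points which return to their own `q`-fibre infinitely often. -/
def recurrentSet (S : Y → Y) (q : Y → W) : Set Y :=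
  {y | ∃ᶠ n in atTop, q (S^[n] y) = q y}

open Classical in
/-- The first return time to the own `q`-fibre, set to `1` if there is no return. -/
noncomputable def returnTime (S : Y → Y) (q : Y → W) (y : Y) : ℕ :=
  if h : ∃ n, y ∈ firstReturnSet S q n then h.choose else 1

/-- The first return map to the own `q`-fibre. -/
noncomputable def returnMap (S : Y → Y) (q : Y → W) (y : Y) : Y :=
  S^[returnTime S q y] y

lemma firstReturnSet_unique {S : Y → Y} {q : Y → W} {y : Y} {n m : ℕ}
    (hn : y ∈ firstReturnSet S q n) (hm : y ∈ firstReturnSet S q m) : n = m := by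
  rcases lt_trichotomy n m with h | h | h
  · exact absurd hn.2.1 (hm.2.2 n hn.1 h)
  · exact h
  · exact absurd hm.2.1 (hn.2.2 m hm.1 h)

lemma pairwise_disjoint_firstReturnSet (S : Y → Y) (q : Y → W) :
    Pairwise (Function.onFun Disjoint (firstReturnSet S q)) := fun _ _ hnm =>
  Set.disjoint_left.2 fun _ hn hm => hnm (firstReturnSet_unique hn hm)

lemma returnTime_eq {S : Y → Y} {q : Y → W} {y : Y} {n : ℕ}
    (hn : y ∈ firstReturnSet S q n) : returnTime S q y = n := by
  have h : ∃ n, y ∈ firstReturnSet S q n := ⟨n, hn⟩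
  rw [returnTime, dif_pos h]
  exact firstReturnSet_unique h.choose_spec hn

lemma returnTime_eq_one {S : Y → Y} {q : Y → W} {y : Y}
    (h : ¬ ∃ n, y ∈ firstReturnSet S q n) : returnTime S q y = 1 := by
  rw [returnTime, dif_neg h]

lemma sInf_mem_firstReturnSet {S : Y → Y} {q : Y → W} {y : Y}
    (hy : y ∈ recurrentSet S q) :
    y ∈ firstReturnSet S q (sInf {n | 0 < n ∧ q (S^[n] y) = q y}) := by
  have hne : {n | 0 < n ∧ q (S^[n] y) = q y}.Nonempty := by
    obtain ⟨n, hn, h⟩ := (frequently_atTop.1 hy) 1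
    exact ⟨n, hn, h⟩
  have := Nat.sInf_mem hne
  exact ⟨this.1, this.2, fun m h0 hm h => Nat.notMem_of_lt_sInf hm ⟨h0, h⟩⟩

lemma returnTime_eq_sInf {S : Y → Y} {q : Y → W} {y : Y} (hy : y ∈ recurrentSet S q) :
    returnTime S q y = sInf {n | 0 < n ∧ q (S^[n] y) = q y} :=
  returnTime_eq (sInf_mem_firstReturnSet hy)

lemma q_returnMap {S : Y → Y} {q : Y → W} {y : Y} (hy : y ∈ recurrentSet S q) :
    q (returnMap S q y) = q y := by
  have := (sInf_mem_firstReturnSet hy).2.1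
  rwa [returnMap, returnTime_eq_sInf hy]

/-- The returned point lies in the same fibre and on the same orbit, so every later return of `y` is
one of its own returns. This allows the return map to be iterated. -/
lemma returnMap_mem_recurrentSet {S : Y → Y} {q : Y → W} {y : Y} (hy : y ∈ recurrentSet S q) :
    returnMap S q y ∈ recurrentSet S q := by
  have hq := q_returnMap hy
  rw [recurrentSet, Set.mem_ofPred_eq, hq, frequently_atTop]
  intro a
  obtain ⟨b, hb, h⟩ := frequently_atTop.1 hy (a + returnTime S q y)
  refine ⟨b - returnTime S q y, by omega, ?_⟩
  rw [returnMap, ← Function.iterate_add_apply, Nat.sub_add_cancel (by omega), h]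

lemma iterate_returnMap_mem_recurrentSet {S : Y → Y} {q : Y → W} {y : Y}
    (hy : y ∈ recurrentSet S q) (j : ℕ) :
    (returnMap S q)^[j] y ∈ recurrentSet S q ∧ q ((returnMap S q)^[j] y) = q y := by
  induction j with
  | zero => exact ⟨hy, rfl⟩
  | succ j ih =>
    rw [Function.iterate_succ_apply']
    exact ⟨returnMap_mem_recurrentSet ih.1, (q_returnMap ih.1).trans ih.2⟩

/-- Splitting by the value of the return time reduces measurability to countably many pieces; the
last piece comes from the default value `1` at points without return. -/
lemma preimage_returnMap (S : Y → Y) (q : Y → W) (A : Set Y) :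
    returnMap S q ⁻¹' A = (⋃ n, firstReturnSet S q n ∩ S^[n] ⁻¹' A) ∪
      ((⋃ n, firstReturnSet S q n)ᶜ ∩ S ⁻¹' A) := by
  ext y
  by_cases h : ∃ n, y ∈ firstReturnSet S q n
  · obtain ⟨n, hn⟩ := h
    have h1 : y ∈ ⋃ n, firstReturnSet S q n := Set.mem_iUnion.2 ⟨n, hn⟩
    simp only [Set.mem_preimage, returnMap, returnTime_eq hn, Set.mem_union, Set.mem_inter_iff,
      Set.mem_compl_iff, h1, not_true_eq_false, false_and, or_false, Set.mem_iUnion]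
    exact ⟨fun h => ⟨n, hn, h⟩, fun ⟨m, hm, h⟩ => firstReturnSet_unique hm hn ▸ h⟩
  · have h' := not_exists.1 h
    simp [returnMap, returnTime_eq_one h, h']

lemma measurableSet_fibre_eq {m : MeasurableSpace Y} {S : Y → Y} {q : Y → W}
    (hS : Measurable S) (hq : (Set.range q).Countable) (hqm : ∀ w, MeasurableSet (q ⁻¹' {w}))
    (n : ℕ) : MeasurableSet {y | q (S^[n] y) = q y} := by
  have : {y | q (S^[n] y) = q y} =
      ⋃ w ∈ Set.range q, (S^[n] ⁻¹' (q ⁻¹' {w})) ∩ q ⁻¹' {w} := by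
    ext y
    simp only [Set.mem_iUnion, Set.mem_inter_iff, Set.mem_preimage, Set.mem_singleton_iff,
      exists_prop]
    exact ⟨fun h => ⟨q y, ⟨y, rfl⟩, h, rfl⟩, fun ⟨w, _, h1, h2⟩ => h1.trans h2.symm⟩
  rw [this]
  exact .biUnion hq fun w _ => ((hS.iterate n) (hqm w)).inter (hqm w)

lemma measurableSet_firstReturnSet {m : MeasurableSpace Y} {S : Y → Y} {q : Y → W}
    (hS : Measurable S) (hq : (Set.range q).Countable) (hqm : ∀ w, MeasurableSet (q ⁻¹' {w}))
    (n : ℕ) : MeasurableSet (firstReturnSet S q n) := by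
  have : firstReturnSet S q n = {y | 0 < n} ∩ ({y | q (S^[n] y) = q y} ∩
      ⋂ m, ⋂ (_ : 0 < m), ⋂ (_ : m < n), {y | q (S^[m] y) = q y}ᶜ) := by
    ext y
    simp [firstReturnSet]
  rw [this]
  exact (MeasurableSet.const _).inter ((measurableSet_fibre_eq hS hq hqm n).inter
    (.iInter fun m => .iInter fun _ => .iInter fun _ =>
      (measurableSet_fibre_eq hS hq hqm m).compl))

/-- If `S` maps the "present" `m'` into the "past" `m`, then so does the return map. -/
lemma measurable_returnMap {m m' : MeasurableSpace Y} (hm : m ≤ m') {S : Y → Y} {q : Y → W}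
    (hS : Measurable[m, m'] S) (hq : (Set.range q).Countable)
    (hqm : ∀ w, MeasurableSet[m] (q ⁻¹' {w})) : Measurable[m, m'] (returnMap S q) := by
  have hSm : Measurable[m, m] S := hS.mono le_rfl hm
  intro A hA
  rw [preimage_returnMap]
  refine MeasurableSet.union (.iUnion fun n => ?_) ((MeasurableSet.iUnion fun n =>
    measurableSet_firstReturnSet hSm hq hqm n).compl.inter (hS hA))
  -- Return time 0 is impossible. For `n + 1`, one application of `S` pulls `m'` back to `m`, and
  -- the remaining `n` stay inside `m`.
  rcases n with _ | n
  · simp [firstReturnSet]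
  · refine (measurableSet_firstReturnSet hSm hq hqm _).inter ?_
    rw [Function.iterate_succ']
    exact (hSm.iterate n) (hS hA)

/-- Poincaré recurrence, applied to each of the countably many fibres. -/
lemma ae_mem_recurrentSet [MeasurableSpace Y] {P : Measure Y} [IsFiniteMeasure P] {S : Y → Y}
    {q : Y → W} (hS : MeasurePreserving S P P) (hq : (Set.range q).Countable)
    (hqm : ∀ w, MeasurableSet (q ⁻¹' {w})) : ∀ᵐ y ∂P, y ∈ recurrentSet S q := by
  have h : ∀ w ∈ Set.range q, ∀ᵐ y ∂P, y ∈ q ⁻¹' {w} → ∃ᶠ n in atTop, S^[n] y ∈ q ⁻¹' {w} :=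
    fun w _ => hS.conservative.ae_mem_imp_frequently_image_mem (hqm w).nullMeasurableSet
  filter_upwards [(ae_ball_iff hq).2 h] with y hy
  exact hy (q y) ⟨y, rfl⟩ rfl

lemma ae_mem_iUnion_firstReturnSet [MeasurableSpace Y] {P : Measure Y} [IsFiniteMeasure P]
    {S : Y → Y} {q : Y → W} (hS : MeasurePreserving S P P) (hq : (Set.range q).Countable)
    (hqm : ∀ w, MeasurableSet (q ⁻¹' {w})) : ∀ᵐ y ∂P, y ∈ ⋃ n, firstReturnSet S q n := by
  filter_upwards [ae_mem_recurrentSet hS hq hqm] with y hy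
  exact Set.mem_iUnion.2 ⟨_, sInf_mem_firstReturnSet hy⟩

/-- Time reversal: the orbit segment from `y` to its `n`-th iterate, read backwards, is again a
first return, with the intermediate time `m` becoming `n - m`. -/
lemma preimage_firstReturnSet_symm (S : Y ≃ Y) (q : Y → W) (n : ℕ) :
    S^[n] ⁻¹' firstReturnSet S.symm q n = firstReturnSet S q n := by
  have key : ∀ y m, m ≤ n → S.symm^[m] (S^[n] y) = S^[n - m] y := by
    intro y m hm
    have : n = m + (n - m) := by omega
    conv_lhs => rw [this, Function.iterate_add_apply]
    exact (Function.LeftInverse.iterate S.left_inv m) _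
  ext y
  simp only [firstReturnSet, Set.mem_preimage, Set.mem_ofPred_eq]
  rw [key y n le_rfl, Nat.sub_self, Function.iterate_zero_apply]
  constructor
  · rintro ⟨h0, h1, h2⟩
    refine ⟨h0, h1.symm, fun m hm0 hm h => h2 (n - m) (by omega) (by omega) ?_⟩
    rw [key y _ (by omega), Nat.sub_sub_self hm.le, h, h1]
  · rintro ⟨h0, h1, h2⟩
    refine ⟨h0, h1.symm, fun m hm0 hm h => h2 (n - m) (by omega) (by omega) ?_⟩
    rw [key y _ hm.le] at h
    rw [h, h1]

/-- The return map to the fibres of a countably valued function is measure preserving. -/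
theorem measurePreserving_returnMap [MeasurableSpace Y] {P : Measure Y} [IsFiniteMeasure P]
    {S : Y ≃ᵐ Y} {q : Y → W} (hS : MeasurePreserving S P P) (hq : (Set.range q).Countable)
    (hqm : ∀ w, MeasurableSet (q ⁻¹' {w})) : MeasurePreserving (returnMap S q) P P := by
  have hR : Measurable (returnMap S q) := measurable_returnMap le_rfl S.measurable hq hqm
  refine ⟨hR, Measure.ext fun A hA => ?_⟩
  rw [Measure.map_apply hR hA]
  have hS' : MeasurePreserving S.symm P P := hS.symm
  have split : ∀ T : Y ≃ᵐ Y, MeasurePreserving T P P → ∀ B : Set Y,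
      (∀ᵐ y ∂P, y ∈ B ↔ y ∈ ⋃ n, firstReturnSet T q n ∩ B) := fun T hT B => by
    filter_upwards [ae_mem_iUnion_firstReturnSet hT hq hqm] with y hy
    rw [← Set.iUnion_inter]
    exact ⟨fun h => ⟨hy, h⟩, fun h => h.2⟩
  have h1 : P (returnMap S q ⁻¹' A) = P (⋃ n, firstReturnSet S q n ∩ S^[n] ⁻¹' A) := by
    refine measure_congr ?_
    filter_upwards [ae_mem_iUnion_firstReturnSet hS hq hqm] with y hy
    rw [preimage_returnMap]
    refine propext ⟨fun h => h.resolve_right fun h => h.1 hy, Or.inl⟩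
  have h2 : P A = P (⋃ n, firstReturnSet S.symm q n ∩ A) := by
    refine measure_congr ?_
    filter_upwards [split S.symm hS' A] with y hy
    exact propext hy
  have disj : ∀ (T : Y ≃ᵐ Y) (C : ℕ → Set Y),
      Pairwise (Function.onFun Disjoint fun n => firstReturnSet T q n ∩ C n) := fun T C n m hnm =>
    (pairwise_disjoint_firstReturnSet T q hnm).mono Set.inter_subset_left Set.inter_subset_left
  have hmeas : ∀ (T : Y ≃ᵐ Y) n, MeasurableSet (firstReturnSet T q n) := fun T n =>
    measurableSet_firstReturnSet T.measurable hq hqm n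
  -- The preimage is cut by the forward return time and `A` by the backward one; by time reversal,
  -- `S^[n]` pulls the `n`-th piece of `A` back to the `n`-th piece of the preimage.
  rw [h1, h2, measure_iUnion (disj S fun n => S^[n] ⁻¹' A) fun n =>
      (hmeas S n).inter ((S.measurable.iterate n) hA),
    measure_iUnion (disj S.symm fun _ => A) fun n => (hmeas S.symm n).inter hA]
  refine tsum_congr fun n => ?_
  have := preimage_firstReturnSet_symm S.toEquiv q n
  rw [← (hS.iterate n).measure_preimage ((hmeas S.symm n).inter hA).nullMeasurableSet,
    Set.preimage_inter]
  congr 2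
  exact this.symm

end ReturnMap

/-! ### Orthogonality of innovations and the L¹ bound for averages along returns. -/

section Averages

variable {Y : Type*}

lemma integral_mul_eq_zero_of_condExp_eq_zero {m mY : MeasurableSpace Y} {P : Measure Y}
    [IsFiniteMeasure P] (hm : m ≤ mY) {D g : Y → ℝ} (hD : MemLp D 2 P) (hg : MemLp g 2 P)
    (hgm : StronglyMeasurable[m] g) (hD0 : P[D | m] =ᵐ[P] 0) : ∫ y, g y * D y ∂P = 0 := by
  have hint : Integrable (g * D) P := hg.integrable_mul hD
  have h1 := condExp_mul_of_stronglyMeasurable_left hgm hint (hD.integrable one_le_two)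
  rw [← integral_condExp hm (f := fun y => g y * D y)]
  refine integral_eq_zero_of_ae ?_
  refine h1.trans ?_
  filter_upwards [hD0] with y hy
  simp [hy]

lemma memLp_birkhoffSum {mY : MeasurableSpace Y} {P : Measure Y} {R : Y → Y}
    (hR : MeasurePreserving R P P) {D : Y → ℝ} {p : ℝ≥0∞} (hD : MemLp D p P) (J : ℕ) :
    MemLp (birkhoffSum R D J) p P := by
  have : birkhoffSum R D J = ∑ j ∈ Finset.range J, D ∘ R^[j] := by
    ext y; simp [birkhoffSum]
  rw [this]
  exact memLp_finsetSum' _ fun j _ => hD.comp_measurePreserving (hR.iterate j)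

/-- Orthogonality: if `R` maps the present `m'` into the past `m` and `D` is a present innovation
with respect to the past, the second moments of the summands in the Birkhoff sums add up. -/
lemma integral_birkhoffSum_sq {m m' mY : MeasurableSpace Y} {P : Measure Y} [IsFiniteMeasure P]
    (hmm' : m ≤ m') (hm' : m' ≤ mY) {R : Y → Y} (hR : MeasurePreserving R P P)
    (hRm : Measurable[m, m'] R) {D : Y → ℝ} (hD : MemLp D 2 P) (hDm : StronglyMeasurable[m'] D)
    (hD0 : P[D | m] =ᵐ[P] 0) (J : ℕ) :
    ∫ y, birkhoffSum R D J y ^ 2 ∂P = J * ∫ y, D y ^ 2 ∂P := by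
  induction J with
  | zero => simp
  | succ J ih =>
    set U : Y → ℝ := birkhoffSum R D J
    have hU : MemLp U 2 P := memLp_birkhoffSum hR hD J
    have hUm : StronglyMeasurable[m'] U := by
      have : U = ∑ j ∈ Finset.range J, D ∘ R^[j] := by
        ext y; simp [U, birkhoffSum]
      rw [this]
      exact Finset.stronglyMeasurable_sum _ fun j _ => hDm.comp_measurable
        (Measurable.iterate (hRm.mono hmm' le_rfl) j)
    have hUR : MemLp (U ∘ R) 2 P := hU.comp_measurePreserving hR
    -- The later summands form `U ∘ R`, which is measurable with respect to the past, so the cross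
    -- term with `D` vanishes.
    have h0 := integral_mul_eq_zero_of_condExp_eq_zero (hmm'.trans hm') hD hUR
      (hUm.comp_measurable hRm) hD0
    have e : ∀ y, birkhoffSum R D (J + 1) y ^ 2
        = D y ^ 2 + 2 * ((U ∘ R) y * D y) + (U ∘ R) y ^ 2 := fun y => by
      rw [birkhoffSum_succ']; simp only [U, Function.comp]; ring
    have h1 : ∫ y, (U ∘ R) y ^ 2 ∂P = ∫ y, U y ^ 2 ∂P := by
      have := integral_map (μ := P) hR.aemeasurable (f := fun y => U y ^ 2)
        (by rw [hR.map_eq]; exact (hU.aestronglyMeasurable.pow 2))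
      rw [hR.map_eq] at this
      exact this.symm
    have hc : Integrable (fun y => 2 * ((U ∘ R) y * D y)) P :=
      (hUR.integrable_mul hD).const_mul 2
    have hs : Integrable (fun y => D y ^ 2 + 2 * ((U ∘ R) y * D y)) P := hD.integrable_sq.add hc
    simp_rw [e]
    rw [integral_add hs hUR.integrable_sq, integral_add hD.integrable_sq hc,
      integral_const_mul, h0, h1, ih]
    push_cast; ring

/-- The inequality |U| ≤ U²/(2√J) + √J/2 balances the second moment, which is of order J. -/
lemma integral_abs_birkhoffSum_le {m m' mY : MeasurableSpace Y} {P : Measure Y}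
    [IsProbabilityMeasure P]
    (hmm' : m ≤ m') (hm' : m' ≤ mY) {R : Y → Y} (hR : MeasurePreserving R P P)
    (hRm : Measurable[m, m'] R) {D : Y → ℝ} (hD : MemLp D 2 P) (hDm : StronglyMeasurable[m'] D)
    (hD0 : P[D | m] =ᵐ[P] 0) {J : ℕ} (hJ : 0 < J) :
    ∫ y, |birkhoffSum R D J y| ∂P ≤ √J * ((1 + ∫ y, D y ^ 2 ∂P) / 2) := by
  have hU : MemLp (birkhoffSum R D J) 2 P := memLp_birkhoffSum hR hD J
  have hJ' : (0 : ℝ) < √J := Real.sqrt_pos.2 (by exact_mod_cast hJ)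
  have hJs : √(J : ℝ) * √J = J := Real.mul_self_sqrt (by positivity)
  have hb : ∀ y, |birkhoffSum R D J y| ≤ (√J)⁻¹ / 2 * birkhoffSum R D J y ^ 2 + √J / 2 := fun y => by
    have h : 0 ≤ (√J)⁻¹ * (|birkhoffSum R D J y| - √J) ^ 2 := by positivity
    have e : (√J)⁻¹ * (|birkhoffSum R D J y| - √J) ^ 2
        = (√J)⁻¹ * birkhoffSum R D J y ^ 2 - 2 * |birkhoffSum R D J y| + √J := by
      rw [← sq_abs (birkhoffSum R D J y)]
      field_simp
      ring
    linarith
  calc ∫ y, |birkhoffSum R D J y| ∂P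
      ≤ ∫ y, ((√J)⁻¹ / 2 * birkhoffSum R D J y ^ 2 + √J / 2) ∂P :=
        integral_mono (hU.integrable one_le_two).abs
          ((hU.integrable_sq.const_mul _).add (integrable_const _)) hb
    _ = (√J)⁻¹ / 2 * (J * ∫ y, D y ^ 2 ∂P) + √J / 2 := by
        rw [integral_add (hU.integrable_sq.const_mul _) (integrable_const _), integral_const_mul,
          integral_birkhoffSum_sq hmm' hm' hR hRm hD hDm hD0]
        simp
    _ = √J * ((1 + ∫ y, D y ^ 2 ∂P) / 2) := by
        nth_rewrite 2 [← hJs]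
        field_simp
        ring

/-- The mean distance between the averages of `f` along the returns to the fibres of `q` and the
conditional expectation of `f` given the past is controlled by the number of returns and the
distance between the conditional expectations of `f` given the past and given `q`. -/
theorem integral_abs_average_returnMap_sub_le {W : Type*} {m m' mY : MeasurableSpace Y}
    {P : Measure Y} [IsProbabilityMeasure P] (hmm' : m ≤ m') (hm' : m' ≤ mY) {S : Y ≃ᵐ Y}
    (hS : MeasurePreserving S P P) (hSm : Measurable[m, m'] S) {q : Y → W}
    (hq : (Set.range q).Countable) (hqm : ∀ w, MeasurableSet[m] (q ⁻¹' {w})) {f : Y → ℝ}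
    (hf : MemLp f 2 P) (hfm : StronglyMeasurable[m'] f) {J : ℕ} (hJ : 0 < J) :
    ∫ y, |(J : ℝ)⁻¹ * ∑ j ∈ Finset.range J, f ((returnMap S q)^[j + 1] y) - (P[f | m]) y| ∂P ≤
      (√J)⁻¹ * ((1 + ∫ y, (f y - (P[f | m]) y) ^ 2 ∂P) / 2) +
        2 * ∫ y, |(P[f | MeasurableSpace.comap q ⊤]) y - (P[f | m]) y| ∂P := by
  have hm : m ≤ mY := hmm'.trans hm'
  have hqY : ∀ w, MeasurableSet (q ⁻¹' {w}) := fun w => hm _ (hqm w)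
  set R := returnMap S q
  set h := P[f | m]
  set g := P[f | MeasurableSpace.comap q ⊤]
  have hR : MeasurePreserving R P P := measurePreserving_returnMap hS hq hqY
  have hRm : Measurable[m, m'] R := measurable_returnMap hmm' hSm hq hqm
  have hh : MemLp h 2 P := hf.condExp one_le_two
  have hD : MemLp (f - h) 2 P := hf.sub hh
  have hDm : StronglyMeasurable[m'] (f - h) := hfm.sub (stronglyMeasurable_condExp.mono hmm')
  have hD0 : P[f - h | m] =ᵐ[P] 0 := by
    refine (condExp_sub (hf.integrable one_le_two) integrable_condExp m).trans ?_
    rw [condExp_of_stronglyMeasurable hm stronglyMeasurable_condExp integrable_condExp]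
    simp
  have hJ0 : (0 : ℝ) < J := by exact_mod_cast hJ
  have hJs : √(J : ℝ) * √J = J := Real.mul_self_sqrt hJ0.le
  -- With the discrete σ-field on `W`, the chosen version of `g` is exactly constant on fibres,
  -- hence unchanged along returns of recurrent points.
  have hfact : Function.FactorsThrough g q := by
    let _ : MeasurableSpace W := ⊤
    exact (stronglyMeasurable_condExp (f := f) (μ := P)
      (m := MeasurableSpace.comap q ⊤)).factorsThrough
  have hgh : Integrable (fun y => |g y - h y|) P := (integrable_condExp.sub integrable_condExp).abs
  have hghj : ∀ j, Integrable (fun y => |g (R^[j] y) - h (R^[j] y)|) P := fun j =>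
    (hR.iterate j).integrable_comp_of_integrable hgh
  have hghi : ∀ j, ∫ y, |g (R^[j] y) - h (R^[j] y)| ∂P = ∫ y, |g y - h y| ∂P := fun j => by
    have hRj := hR.iterate j
    have := integral_map (μ := P) hRj.aemeasurable (f := fun y => |g y - h y|)
      (by rw [hRj.map_eq]; exact hgh.aestronglyMeasurable)
    rw [hRj.map_eq] at this
    exact this.symm
  have hU : Integrable (birkhoffSum R (f - h) J) P := (memLp_birkhoffSum hR hD J).integrable one_le_two
  have hUR : Integrable (fun y => |birkhoffSum R (f - h) J (R y)|) P :=
    hR.integrable_comp_of_integrable hU.abs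
  have hURi : ∫ y, |birkhoffSum R (f - h) J (R y)| ∂P = ∫ y, |birkhoffSum R (f - h) J y| ∂P := by
    have := integral_map (μ := P) hR.aemeasurable (f := fun y => |birkhoffSum R (f - h) J y|)
      (by rw [hR.map_eq]; exact hU.abs.aestronglyMeasurable)
    rw [hR.map_eq] at this
    exact this.symm
  have hsum : Integrable (fun y => ∑ j ∈ Finset.range J, |g (R^[j + 1] y) - h (R^[j + 1] y)|) P :=
    integrable_finsetSum _ fun j _ => hghj (j + 1)
  have hbound : ∀ᵐ y ∂P, |(J : ℝ)⁻¹ * ∑ j ∈ Finset.range J, f (R^[j + 1] y) - h y| ≤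
      (J : ℝ)⁻¹ * |birkhoffSum R (f - h) J (R y)| +
        (J : ℝ)⁻¹ * ∑ j ∈ Finset.range J, |g (R^[j + 1] y) - h (R^[j + 1] y)| + |g y - h y| := by
    filter_upwards [ae_mem_recurrentSet hS hq hqY] with y hy
    have hg : ∀ j, g (R^[j] y) = g y := fun j =>
      hfact (iterate_returnMap_mem_recurrentSet hy j).2
    -- Since `g (R^[j + 1] y) = g y`, the average of `g` along the returns cancels against `g y`.
    have e : (J : ℝ)⁻¹ * ∑ j ∈ Finset.range J, f (R^[j + 1] y) - h y =
        (J : ℝ)⁻¹ * birkhoffSum R (f - h) J (R y) -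
          (J : ℝ)⁻¹ * ∑ j ∈ Finset.range J, (g (R^[j + 1] y) - h (R^[j + 1] y)) + (g y - h y) := by
      simp only [birkhoffSum, ← Function.iterate_succ_apply, Finset.sum_sub_distrib, hg,
        Pi.sub_apply, Finset.sum_const, Finset.card_range, nsmul_eq_mul]
      field_simp
      ring
    rw [e]
    refine (abs_add_le _ _).trans (add_le_add_left ((abs_sub _ _).trans ?_) _)
    rw [abs_mul, abs_mul, abs_of_pos (inv_pos.2 hJ0)]
    gcongr
    exact Finset.abs_sum_le_sum_abs _ _
  calc _ ≤ ∫ y, ((J : ℝ)⁻¹ * |birkhoffSum R (f - h) J (R y)| +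
        (J : ℝ)⁻¹ * ∑ j ∈ Finset.range J, |g (R^[j + 1] y) - h (R^[j + 1] y)| + |g y - h y|) ∂P :=
        integral_mono_of_nonneg (.of_forall fun _ => abs_nonneg _)
          (((hUR.const_mul _).add (hsum.const_mul _)).add hgh) hbound
    _ = (J : ℝ)⁻¹ * ∫ y, |birkhoffSum R (f - h) J y| ∂P + 2 * ∫ y, |g y - h y| ∂P := by
        have hs : Integrable (fun y => (J : ℝ)⁻¹ * |birkhoffSum R (f - h) J (R y)| +
            (J : ℝ)⁻¹ * ∑ j ∈ Finset.range J, |g (R^[j + 1] y) - h (R^[j + 1] y)|) P :=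
          (hUR.const_mul _).add (hsum.const_mul _)
        rw [integral_add hs hgh, integral_add (hUR.const_mul _) (hsum.const_mul _), integral_const_mul,
          integral_const_mul, hURi, integral_finsetSum _ fun j _ => hghj (j + 1)]
        simp only [hghi, Finset.sum_const, Finset.card_range, nsmul_eq_mul]
        field_simp
        ring
    _ ≤ _ := by
        refine add_le_add ?_ le_rfl
        refine (mul_le_mul_of_nonneg_left
          (integral_abs_birkhoffSum_le hmm' hm' hR hRm hD hDm hD0 hJ) (inv_pos.2 hJ0).le).trans_eq ?_
        have : (J : ℝ)⁻¹ * √J = (√J)⁻¹ := by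
          nth_rewrite 1 [← hJs]
          have : √(J : ℝ) ≠ 0 := (Real.sqrt_pos.2 hJ0).ne'
          field_simp
        rw [← mul_assoc, this]
        rfl

end Averages

/-- Conditional expectation commutes with measure preserving maps. -/
lemma condExp_comp_measurePreserving {Ω Y : Type*} {mΩ : MeasurableSpace Ω}
    {m mY : MeasurableSpace Y} {μ : Measure Ω} {P : Measure Y} [IsFiniteMeasure μ]
    [IsFiniteMeasure P] (hm : m ≤ mY) {Φ : Ω → Y} (hΦ : MeasurePreserving Φ μ P) {f : Y → ℝ}
    (hf : Integrable f P) : (P[f | m]) ∘ Φ =ᵐ[μ] μ[f ∘ Φ | m.comap Φ] := by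
  have hle : m.comap Φ ≤ mΩ := (MeasurableSpace.comap_mono hm).trans hΦ.measurable.comap_le
  refine ae_eq_condExp_of_forall_setIntegral_eq hle
    (hΦ.integrable_comp_of_integrable hf)
    (fun s _ _ => (hΦ.integrable_comp_of_integrable integrable_condExp).integrableOn) ?_
    (StronglyMeasurable.aestronglyMeasurable
      (stronglyMeasurable_condExp.comp_measurable (comap_measurable Φ)))
  rintro _ ⟨A, hA, rfl⟩ _
  have key : ∀ g : Y → ℝ, Integrable g P → ∫ x in Φ ⁻¹' A, (g ∘ Φ) x ∂μ = ∫ y in A, g y ∂P :=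
    fun g hg => by
      have := setIntegral_map (μ := μ) (g := Φ) (f := g) (hm _ hA)
        (by rw [hΦ.map_eq]; exact hg.aestronglyMeasurable) hΦ.aemeasurable
      rw [hΦ.map_eq] at this
      exact this.symm
  rw [key _ integrable_condExp, key _ hf, setIntegral_condExp hm hf hA]

/-! ### Atoms of finite fields. -/

section Quantize

variable {S : Type*} {𝓕 : MeasurableSpace S}

/-- Membership in a set of the field can be read off the atom, so the quantizer loses no information
about `𝓕`. -/
lemma preimage_quantize_setOf_subset {A : Set S} (hA : MeasurableSet[𝓕] A) :
    quantize 𝓕 ⁻¹' {C | C ⊆ A} = A := by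
  ext x
  exact ⟨fun h => h (@mem_measurableAtom_self S 𝓕 x), fun h => @measurableAtom_subset S 𝓕 A x hA h⟩

lemma measurableSet_quantize (h𝓕 : {B : Set S | MeasurableSet[𝓕] B}.Finite) (x : S) :
    MeasurableSet[𝓕] (quantize 𝓕 x) := by
  have : quantize 𝓕 x = ⋂ s ∈ {B : Set S | MeasurableSet[𝓕] B}, ⋂ (_ : x ∈ s), s := by
    ext z
    simp only [quantize, measurableAtom, Set.mem_iInter]
    exact ⟨fun h s hs hx => h s hx hs, fun h s hx hs => h s hs hx⟩
  rw [this]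
  exact .biInter h𝓕.countable fun s hs => .iInter fun _ => hs

lemma finite_range_quantize (h𝓕 : {B : Set S | MeasurableSet[𝓕] B}.Finite) :
    (Set.range (quantize 𝓕)).Finite :=
  h𝓕.subset (Set.range_subset_iff.2 (measurableSet_quantize h𝓕))

lemma measurableSet_preimage_quantize (h𝓕 : {B : Set S | MeasurableSet[𝓕] B}.Finite) (C : Set S) :
    MeasurableSet[𝓕] (quantize 𝓕 ⁻¹' {C}) := by
  by_cases hC : C ∈ Set.range (quantize 𝓕)
  · obtain ⟨x, rfl⟩ := hC
    have : quantize 𝓕 ⁻¹' {quantize 𝓕 x} = quantize 𝓕 x := by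
      ext z
      refine ⟨fun h => ?_, fun h => @measurableAtom_eq_of_mem S 𝓕 z x h⟩
      have hz : z ∈ quantize 𝓕 z := @mem_measurableAtom_self S 𝓕 z
      rwa [show quantize 𝓕 z = quantize 𝓕 x from h] at hz
    rw [this]
    exact measurableSet_quantize h𝓕 x
  · rw [Set.preimage_singleton_eq_empty.2 hC]
    exact MeasurableSet.empty

end Quantize

/-! ### Sequence space: recurrence times as return maps, and the pattern filtration. -/

section Canonical

variable {S : Type*}

/-- The coordinate process on the space of two-sided sequences. -/
abbrev coordMap (S : Type*) : ℤ → (ℤ → S) → S := fun t y => y t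

lemma recurrenceTime_eq_coordMap {Ω : Type*} (𝓕 : MeasurableSpace S) (X : ℤ → Ω → S) (ℓ : ℕ)
    (ω : Ω) (j : ℕ) : recurrenceTime 𝓕 X ℓ ω j =
      recurrenceTime 𝓕 (coordMap S) ℓ (fun t => X t ω) j := by
  induction j with
  | zero => rfl
  | succ j ih => rw [recurrenceTime, recurrenceTime, ih]; rfl

lemma empiricalConditional_eq_coordMap {Ω : Type*} (𝓕 : MeasurableSpace S)
    [MeasurableSpace S] (X : ℤ → Ω → S) (ℓ J : ℕ) (ω : Ω) : empiricalConditional 𝓕 X ℓ J ω =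
      empiricalConditional 𝓕 (coordMap S) ℓ J (fun t => X t ω) := by
  simp only [empiricalConditional, recurrenceTime_eq_coordMap 𝓕 X]

/-- The shift on two-sided sequences that moves the origin one step into the past. -/
def pastShift (S : Type*) [MeasurableSpace S] : (ℤ → S) ≃ᵐ (ℤ → S) where
  toFun y t := y (t - 1)
  invFun y t := y (t + 1)
  left_inv y := by ext t; simp
  right_inv y := by ext t; simp
  measurable_toFun := measurable_pi_lambda _ fun _ => measurable_pi_apply _
  measurable_invFun := measurable_pi_lambda _ fun _ => measurable_pi_apply _

lemma iterate_pastShift [MeasurableSpace S] (n : ℕ) (y : ℤ → S) (t : ℤ) :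
    (pastShift S)^[n] y t = y (t - n) := by
  induction n generalizing t with
  | zero => simp
  | succ n ih =>
    rw [Function.iterate_succ_apply']
    change (pastShift S)^[n] y (t - 1) = _
    rw [ih]
    congr 1
    push_cast
    ring

/-- The quantized block of the last `ℓ` values before the origin. -/
abbrev pastPattern (𝓕 : MeasurableSpace S) (ℓ : ℕ) (y : ℤ → S) : Fin ℓ → Set S :=
  quantizedPast 𝓕 (coordMap S) ℓ y 0

lemma quantizedPast_eq_pastPattern (𝓕 : MeasurableSpace S) [MeasurableSpace S] (ℓ : ℕ)
    (y : ℤ → S) (t : ℕ) :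
    quantizedPast 𝓕 (coordMap S) ℓ y t = pastPattern 𝓕 ℓ ((pastShift S)^[t] y) := by
  ext1 i
  simp only [pastPattern, quantizedPast, coordMap, iterate_pastShift]
  congr 2
  push_cast
  ring

lemma recurrenceSet_eq (𝓕 : MeasurableSpace S) [MeasurableSpace S] (ℓ : ℕ) (y : ℤ → S) (s : ℕ) :
    recurrenceSet 𝓕 (coordMap S) ℓ y s =
      {t | s < t ∧ pastPattern 𝓕 ℓ ((pastShift S)^[t] y) = pastPattern 𝓕 ℓ y} := by
  simp only [recurrenceSet, quantizedPast_eq_pastPattern _ _ _ _, Function.iterate_zero_apply]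

lemma recurrenceSet_nonempty {𝓕 : MeasurableSpace S} [MeasurableSpace S] {ℓ : ℕ} {y : ℤ → S}
    (hy : y ∈ recurrentSet (pastShift S) (pastPattern 𝓕 ℓ)) (s : ℕ) :
    (recurrenceSet 𝓕 (coordMap S) ℓ y s).Nonempty := by
  obtain ⟨t, ht, h⟩ := frequently_atTop.1 hy (s + 1)
  rw [recurrenceSet_eq]
  exact ⟨t, ht, h⟩

lemma iterate_pastShift_recurrenceTime {𝓕 : MeasurableSpace S} [MeasurableSpace S] {ℓ : ℕ}
    {y : ℤ → S} (hy : y ∈ recurrentSet (pastShift S) (pastPattern 𝓕 ℓ)) (j : ℕ) :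
    (pastShift S)^[recurrenceTime 𝓕 (coordMap S) ℓ y j] y =
      (returnMap (pastShift S) (pastPattern 𝓕 ℓ))^[j] y := by
  induction j with
  | zero => rfl
  | succ j ih =>
    obtain ⟨h1, h2⟩ := iterate_returnMap_mem_recurrentSet hy j
    set τ := recurrenceTime 𝓕 (coordMap S) ℓ y j with hτ
    rw [Function.iterate_succ_apply', returnMap, returnTime_eq_sInf h1, h2, ← ih,
      ← Function.iterate_add_apply]
    congr 1
    -- Recurrence times are counted from the origin and return times from `τ`, so the minimum is
    -- translated by `τ`. Nonemptiness matters: the infimum of the empty set would be 0.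
    have hle : τ ≤ sInf (recurrenceSet 𝓕 (coordMap S) ℓ y τ) :=
      le_csInf (recurrenceSet_nonempty hy τ) fun t ht => ht.1.le
    rw [recurrenceTime, ← hτ]
    rw [recurrenceSet_eq] at hle ⊢
    rw [← Nat.sInf_add hle]
    congr 3
    ext n
    simp [Function.iterate_add_apply]

lemma empiricalConditional_real {𝓕 : MeasurableSpace S} [mS : MeasurableSpace S] {ℓ : ℕ}
    {y : ℤ → S} (hy : y ∈ recurrentSet (pastShift S) (pastPattern 𝓕 ℓ)) (J : ℕ) {B : Set S}
    (hB : MeasurableSet B) :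
    (empiricalConditional 𝓕 (coordMap S) ℓ J y).real B =
      (J : ℝ)⁻¹ * ∑ j ∈ Finset.range J,
        ((coordMap S 0 ⁻¹' B).indicator (fun _ => (1 : ℝ)))
          ((returnMap (pastShift S) (pastPattern 𝓕 ℓ))^[j + 1] y) := by
  have hJ : Finset.Icc 1 J = Finset.Ico (0 + 1) (J + 1) := by
    ext; simp
  rw [empiricalConditional, measureReal_ennreal_smul_apply, ENNReal.toReal_inv,
    ENNReal.toReal_natCast, hJ, ← Finset.sum_Ico_add' _ 0 J 1, ← Finset.range_eq_Ico,
    measureReal_def, Measure.finsetSum_apply, ENNReal.toReal_sum (by simp)]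
  congr 1
  refine Finset.sum_congr rfl fun j _ => ?_
  rw [← iterate_pastShift_recurrenceTime hy, Measure.dirac_apply' _ hB]
  have h0 : (pastShift S)^[recurrenceTime 𝓕 (coordMap S) ℓ y (j + 1)] y ∈
      coordMap S 0 ⁻¹' B ↔ y (-(recurrenceTime 𝓕 (coordMap S) ℓ y (j + 1) : ℤ)) ∈ B := by
    simp only [Set.mem_preimage, coordMap, iterate_pastShift, zero_sub]
  by_cases hy' : y (-(recurrenceTime 𝓕 (coordMap S) ℓ y (j + 1) : ℤ)) ∈ B
  · rw [Set.indicator_of_mem (h0.2 hy'), Set.indicator_of_mem hy']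
    simp
  · rw [Set.indicator_of_notMem (h0.not.2 hy'), Set.indicator_of_notMem hy']
    simp

/-- Finitely many patterns occur, each fixed by finitely many atoms; conversely the events of one
coordinate are read off its atom. Comparing pattern σ-fields thus reduces to comparing coordinates.
-/
lemma comap_pastPattern {𝓕 : MeasurableSpace S}
    (h𝓕 : {B : Set S | MeasurableSet[𝓕] B}.Finite) (ℓ : ℕ) :
    MeasurableSpace.comap (pastPattern 𝓕 ℓ) ⊤ =
      ⨆ i : Fin ℓ, 𝓕.comap (coordMap S (-(ℓ : ℤ) + (i : ℕ))) := by
  have hidx : ∀ (y : ℤ → S) (i : Fin ℓ),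
      pastPattern 𝓕 ℓ y i = quantize 𝓕 (y (-(ℓ : ℤ) + (i : ℕ))) := fun y i => by
    simp [pastPattern, quantizedPast]
  have hfin : (Set.range (pastPattern 𝓕 ℓ)).Finite := by
    refine (Set.Finite.pi' fun _ : Fin ℓ => finite_range_quantize h𝓕).subset ?_
    rintro _ ⟨y, rfl⟩ i
    exact ⟨_, rfl⟩
  refine le_antisymm ?_ (iSup_le fun i => ?_)
  · rintro _ ⟨D, -, rfl⟩
    have : pastPattern 𝓕 ℓ ⁻¹' D = ⋃ w ∈ Set.range (pastPattern 𝓕 ℓ) ∩ D,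
        ⋂ i : Fin ℓ, coordMap S (-(ℓ : ℤ) + (i : ℕ)) ⁻¹' (quantize 𝓕 ⁻¹' {w i}) := by
      ext y
      simp only [Set.mem_preimage, Set.mem_iUnion, Set.mem_iInter, Set.mem_singleton_iff,
        exists_prop, ← hidx]
      exact ⟨fun h => ⟨_, ⟨⟨y, rfl⟩, h⟩, fun _ => rfl⟩, fun ⟨w, ⟨_, hw⟩, h⟩ => funext h ▸ hw⟩
    rw [this]
    exact .biUnion (hfin.countable.mono Set.inter_subset_left) fun w _ => .iInter fun i =>
      le_iSup (fun i : Fin ℓ => 𝓕.comap (coordMap S (-(ℓ : ℤ) + (i : ℕ)))) i _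
        ⟨_, measurableSet_preimage_quantize h𝓕 (w i), rfl⟩
  · rintro _ ⟨A, hA, rfl⟩
    refine ⟨{w | w i ⊆ A}, trivial, ?_⟩
    conv_rhs => rw [← preimage_quantize_setOf_subset hA]
    ext y
    simp only [Set.mem_preimage, Set.mem_ofPred_eq, hidx]

lemma countable_range_pastPattern {𝓕 : MeasurableSpace S}
    (h𝓕 : {B : Set S | MeasurableSet[𝓕] B}.Finite) (ℓ : ℕ) :
    (Set.range (pastPattern 𝓕 ℓ)).Countable := by
  refine ((Set.Finite.pi' fun _ : Fin ℓ => finite_range_quantize h𝓕).subset ?_).countable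
  rintro _ ⟨y, rfl⟩ i
  exact ⟨_, rfl⟩

lemma comap_pastPattern_le_pastSigma {𝓕 : MeasurableSpace S} [mS : MeasurableSpace S]
    (hle : 𝓕 ≤ mS) (h𝓕 : {B : Set S | MeasurableSet[𝓕] B}.Finite) (ℓ : ℕ) :
    MeasurableSpace.comap (pastPattern 𝓕 ℓ) ⊤ ≤ pastSigma (coordMap S) := by
  rw [comap_pastPattern h𝓕]
  refine iSup_le fun i => (MeasurableSpace.comap_mono hle).trans ?_
  have hi : -(ℓ : ℤ) + (i : ℕ) < 0 := by omega
  exact le_iSup₂ (f := fun (t : ℤ) (_ : t < 0) => mS.comap (coordMap S t)) _ hi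

lemma pastSigma_le [mS : MeasurableSpace S] :
    pastSigma (coordMap S) ≤ MeasurableSpace.pi :=
  iSup₂_le fun t _ => (measurable_pi_apply t).comap_le

/-- The σ-field generated by the coordinates up to time `0`. -/
@[reducible] def presentSigma (S : Type*) [mS : MeasurableSpace S] : MeasurableSpace (ℤ → S) :=
  ⨆ (t : ℤ) (_ : t ≤ 0), mS.comap (coordMap S t)

lemma pastSigma_le_presentSigma [mS : MeasurableSpace S] :
    pastSigma (coordMap S) ≤ presentSigma S := iSup₂_le fun t ht =>
  le_iSup₂ (f := fun (t : ℤ) (_ : t ≤ 0) => mS.comap (coordMap S t)) t ht.le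

lemma presentSigma_le [mS : MeasurableSpace S] : presentSigma S ≤ MeasurableSpace.pi :=
  iSup₂_le fun t _ => (measurable_pi_apply t).comap_le

lemma measurable_pastShift [mS : MeasurableSpace S] :
    Measurable[pastSigma (coordMap S), presentSigma S] (pastShift S) := by
  rw [measurable_iff_comap_le]
  simp only [presentSigma, MeasurableSpace.comap_iSup, MeasurableSpace.comap_comp]
  exact iSup₂_le fun t ht => le_iSup₂
    (f := fun (t : ℤ) (_ : t < 0) => mS.comap (coordMap S t)) (t - 1) (by omega)

lemma IsFiniteGeneratingSequence.le [mS : MeasurableSpace S] {𝓑 : ℕ → MeasurableSpace S}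
    (h𝓑 : IsFiniteGeneratingSequence 𝓑) (k : ℕ) : 𝓑 k ≤ mS :=
  h𝓑.generates ▸ le_iSup 𝓑 k

/-- The filtration generated by the quantized pasts. -/
def patternFiltration [mS : MeasurableSpace S] {𝓑 : ℕ → MeasurableSpace S}
    (h𝓑 : IsFiniteGeneratingSequence 𝓑) {ℓ : ℕ → ℕ} (hℓ : Monotone ℓ) :
    Filtration ℕ (MeasurableSpace.pi : MeasurableSpace (ℤ → S)) where
  seq k := MeasurableSpace.comap (pastPattern (𝓑 k) (ℓ k)) ⊤
  mono' k k' hk := by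
    change MeasurableSpace.comap (pastPattern (𝓑 k) (ℓ k)) ⊤ ≤
      MeasurableSpace.comap (pastPattern (𝓑 k') (ℓ k')) ⊤
    rw [comap_pastPattern (h𝓑.finite k), comap_pastPattern (h𝓑.finite k')]
    refine iSup_le fun i => (MeasurableSpace.comap_mono (h𝓑.mono hk)).trans ?_
    have hl := hℓ hk
    -- Blocks are indexed from their oldest entry, so in the longer block the same coordinate sits
    -- `ℓ k' - ℓ k` places later.
    refine le_trans (le_of_eq ?_) (le_iSup (fun i : Fin (ℓ k') =>
      (𝓑 k').comap (coordMap S (-(ℓ k' : ℤ) + (i : ℕ)))) ⟨ℓ k' - ℓ k + i, by omega⟩)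
    congr 2
    push_cast [Nat.cast_sub hl]
    ring
  le' k := (comap_pastPattern_le_pastSigma (h𝓑.le k) (h𝓑.finite k) (ℓ k)).trans pastSigma_le

/-- Each past coordinate eventually enters the window, and is then observed through fields that
generate the whole σ-field. -/
lemma iSup_patternFiltration [mS : MeasurableSpace S] {𝓑 : ℕ → MeasurableSpace S}
    (h𝓑 : IsFiniteGeneratingSequence 𝓑) {ℓ : ℕ → ℕ} (hℓ : Monotone ℓ)
    (hℓ' : Tendsto ℓ atTop atTop) :
    ⨆ k, patternFiltration h𝓑 hℓ k = pastSigma (coordMap S) := by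
  refine le_antisymm (iSup_le fun k =>
    comap_pastPattern_le_pastSigma (h𝓑.le k) (h𝓑.finite k) (ℓ k)) (iSup₂_le fun t ht => ?_)
  have hgen : mS.comap (coordMap S t) = ⨆ k, (𝓑 k).comap (coordMap S t) := by
    conv_lhs => rw [← h𝓑.generates]
    exact MeasurableSpace.comap_iSup
  rw [hgen]
  refine iSup_le fun k => ?_
  obtain ⟨k', hk', hk⟩ := ((tendsto_atTop.1 hℓ' (-t).toNat).and (eventually_ge_atTop k)).exists
  refine le_trans ?_ (le_iSup (fun k => (patternFiltration h𝓑 hℓ k : MeasurableSpace _)) k')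
  change _ ≤ MeasurableSpace.comap (pastPattern (𝓑 k') (ℓ k')) ⊤
  rw [comap_pastPattern (h𝓑.finite k')]
  refine (MeasurableSpace.comap_mono (h𝓑.mono hk)).trans ?_
  refine le_trans (le_of_eq ?_) (le_iSup (fun i : Fin (ℓ k') =>
      (𝓑 k').comap (coordMap S (-(ℓ k' : ℤ) + (i : ℕ)))) ⟨ℓ k' - (-t).toNat, by omega⟩)
  congr 2
  simp only
  omega

lemma ae_mem_recurrentSet_pastPattern {𝓕 : MeasurableSpace S} [mS : MeasurableSpace S]
    {ν : Measure (ℤ → S)} [IsFiniteMeasure ν] (hν : MeasurePreserving (pastShift S) ν ν)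
    (hle : 𝓕 ≤ mS) (h𝓕 : {B : Set S | MeasurableSet[𝓕] B}.Finite) (ℓ : ℕ) :
    ∀ᵐ y ∂ν, y ∈ recurrentSet (pastShift S) (pastPattern 𝓕 ℓ) :=
  ae_mem_recurrentSet hν (countable_range_pastPattern h𝓕 ℓ) fun w =>
    (comap_pastPattern_le_pastSigma hle h𝓕 ℓ).trans pastSigma_le _ ⟨{w}, trivial, rfl⟩

/-- Measurability and integrability come from the almost everywhere equal average along the measure
preserving return map. -/
lemma memLp_empiricalConditional {𝓕 : MeasurableSpace S} [mS : MeasurableSpace S]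
    {ν : Measure (ℤ → S)} [IsProbabilityMeasure ν] (hν : MeasurePreserving (pastShift S) ν ν)
    (hle : 𝓕 ≤ mS) (h𝓕 : {B : Set S | MeasurableSet[𝓕] B}.Finite) (ℓ J : ℕ) {B : Set S}
    (hB : MeasurableSet B) :
    MemLp (fun y => (empiricalConditional 𝓕 (coordMap S) ℓ J y).real B) 1 ν := by
  have hB' : MeasurableSet (coordMap S 0 ⁻¹' B) := measurable_pi_apply 0 hB
  have hR := measurePreserving_returnMap hν (countable_range_pastPattern h𝓕 ℓ) fun w =>
    (comap_pastPattern_le_pastSigma hle h𝓕 ℓ).trans pastSigma_le _ ⟨{w}, trivial, rfl⟩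
  have hf : MemLp ((coordMap S 0 ⁻¹' B).indicator (fun _ => (1 : ℝ))) 1 ν :=
    (memLp_const (1 : ℝ)).indicator hB'
  have h := (memLp_finsetSum (Finset.range J) fun j _ =>
    hf.comp_measurePreserving (hR.iterate (j + 1))).const_mul (J : ℝ)⁻¹
  refine h.ae_eq ?_
  filter_upwards [ae_mem_recurrentSet_pastPattern hν hle h𝓕 ℓ] with y hy
  exact (empiricalConditional_real hy J hB).symm

/-- Convergence of the empirical conditional distributions for the coordinate process. -/
theorem tendsto_empiricalConditional_coordMap [mS : MeasurableSpace S] {ν : Measure (ℤ → S)}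
    [IsProbabilityMeasure ν] (hν : MeasurePreserving (pastShift S) ν ν)
    {𝓑 : ℕ → MeasurableSpace S} (h𝓑 : IsFiniteGeneratingSequence 𝓑) {ℓ J : ℕ → ℕ}
    (hJ_pos : ∀ k, 0 < J k) (hℓ_mono : Monotone ℓ) (hℓ : Tendsto ℓ atTop atTop)
    (hJ : Tendsto J atTop atTop) {B : Set S} (hB : MeasurableSet B) :
    Tendsto (fun k => eLpNorm (fun y =>
      (empiricalConditional (𝓑 k) (coordMap S) (ℓ k) (J k) y).real B
        - (ν⟦coordMap S 0 ⁻¹' B | pastSigma (coordMap S)⟧) y) 1 ν) atTop (𝓝 0) := by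
  set f : (ℤ → S) → ℝ := (coordMap S 0 ⁻¹' B).indicator (fun _ => (1 : ℝ))
  set h := ν[f | pastSigma (coordMap S)]
  have hB0 : MeasurableSet[presentSigma S] (coordMap S 0 ⁻¹' B) :=
    le_iSup₂ (f := fun (t : ℤ) (_ : t ≤ 0) => mS.comap (coordMap S t)) 0 le_rfl _ ⟨B, hB, rfl⟩
  have hfm : StronglyMeasurable[presentSigma S] f := stronglyMeasurable_const.indicator hB0
  have hf : MemLp f 2 ν := (memLp_const (1 : ℝ)).indicator (presentSigma_le _ hB0)
  have hemp := fun k => memLp_empiricalConditional hν (h𝓑.le k) (h𝓑.finite k) (ℓ k) (J k) hB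
  have hnorm : ∀ u : (ℤ → S) → ℝ, Integrable u ν →
      eLpNorm u 1 ν = ENNReal.ofReal (∫ y, |u y| ∂ν) := fun u hu => by
    rw [eLpNorm_one_eq_lintegral_enorm, ← ofReal_integral_norm_eq_lintegral_enorm hu]
    rfl
  have hlevy : Tendsto (fun k => ∫ y, |(ν[f | patternFiltration h𝓑 hℓ_mono k]) y - h y| ∂ν)
      atTop (𝓝 0) := by
    -- Lévy's upward theorem in L¹.
    have := tendsto_eLpNorm_condExp (μ := ν) (ℱ := patternFiltration h𝓑 hℓ_mono) f
    rw [iSup_patternFiltration h𝓑 hℓ_mono hℓ] at this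
    have h2 := (ENNReal.tendsto_toReal ENNReal.zero_ne_top).comp this
    refine h2.congr fun k => ?_
    rw [Function.comp, hnorm _ (integrable_condExp.sub integrable_condExp),
      ENNReal.toReal_ofReal (integral_nonneg fun _ => abs_nonneg _)]
    rfl
  have hsqrt : Tendsto (fun k => (√(J k : ℝ))⁻¹) atTop (𝓝 0) :=
    tendsto_inv_atTop_zero.comp
      (Real.tendsto_sqrt_atTop.comp (tendsto_natCast_atTop_atTop.comp hJ))
  have hbound : Tendsto (fun k => (√(J k : ℝ))⁻¹ * ((1 + ∫ y, (f y - h y) ^ 2 ∂ν) / 2) +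
      2 * ∫ y, |(ν[f | patternFiltration h𝓑 hℓ_mono k]) y - h y| ∂ν) atTop (𝓝 0) := by
    simpa using (hsqrt.mul_const ((1 + ∫ y, (f y - h y) ^ 2 ∂ν) / 2)).add (hlevy.const_mul 2)
  have hreal := squeeze_zero (f := fun k => ∫ y,
      |(empiricalConditional (𝓑 k) (coordMap S) (ℓ k) (J k) y).real B - h y| ∂ν)
    (fun k => integral_nonneg fun _ => abs_nonneg _) (fun k => ?_) hbound
  · have h0 := ENNReal.tendsto_ofReal hreal
    rw [ENNReal.ofReal_zero] at h0
    refine h0.congr fun k => (hnorm _ ?_).symm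
    exact ((hemp k).integrable le_rfl).sub integrable_condExp
  · refine le_trans (le_of_eq (integral_congr_ae ?_)) (integral_abs_average_returnMap_sub_le
      pastSigma_le_presentSigma presentSigma_le hν measurable_pastShift (countable_range_pastPattern (h𝓑.finite k) (ℓ k)) (fun w =>
      comap_pastPattern_le_pastSigma (h𝓑.le k) (h𝓑.finite k) (ℓ k) _ ⟨{w}, trivial, rfl⟩) hf hfm
      (hJ_pos k))
    filter_upwards [ae_mem_recurrentSet_pastPattern hν (h𝓑.le k) (h𝓑.finite k) (ℓ k)] with y hy
    rw [empiricalConditional_real hy _ hB]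

end Canonical

/-! ### Transfer from sequence space to the given process. -/

theorem mainTheorem1 {Ω S : Type*} [MeasurableSpace Ω]
    [TopologicalSpace S] [PolishSpace S] [MeasurableSpace S] [BorelSpace S]
    (μ : Measure Ω) [IsProbabilityMeasure μ]
    (X : ℤ → Ω → S) (hX : ∀ t, Measurable (X t)) (hstat : IsStationaryProcess X μ)
    (𝓑 : ℕ → MeasurableSpace S) (h𝓑 : IsFiniteGeneratingSequence 𝓑)
    (ℓ J : ℕ → ℕ) (hℓ_pos : ∀ k, 0 < ℓ k) (hJ_pos : ∀ k, 0 < J k)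
    (hℓ_mono : Monotone ℓ) (hJ_mono : Monotone J)
    (hℓ : Tendsto ℓ atTop atTop) (hJ : Tendsto J atTop atTop) :
    (∀ᵐ ω ∂μ, ∀ k j : ℕ,
      (recurrenceSet (𝓑 k) X (ℓ k) ω (recurrenceTime (𝓑 k) X (ℓ k) ω j)).Nonempty) ∧
    ∀ B : Set S, (∃ m, MeasurableSet[𝓑 m] B) →
      (∀ k, MemLp (fun ω => (empiricalConditional (𝓑 k) X (ℓ k) (J k) ω).real B) 1 μ) ∧
      Tendsto
        (fun k => eLpNorm
          (fun ω => (empiricalConditional (𝓑 k) X (ℓ k) (J k) ω).real B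
            - (μ⟦X 0 ⁻¹' B | pastSigma X⟧) ω) 1 μ)
        atTop (𝓝 0) := by
  set Φ : Ω → ℤ → S := fun ω t => X t ω 
  have hΦm : Measurable Φ := measurable_pi_lambda _ hX
  set ν := μ.map Φ with hνdef
  have hΦ : MeasurePreserving Φ μ ν := ⟨hΦm, rfl⟩
  have : IsProbabilityMeasure ν := Measure.isProbabilityMeasure_map hΦm.aemeasurable
  have hν : MeasurePreserving (pastShift S) ν ν := by
    refine ⟨(pastShift S).measurable, ?_⟩
    rw [hνdef, Measure.map_map (pastShift S).measurable hΦm]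
    exact hstat (-1)
  refine ⟨ae_all_iff.2 fun k => ?_, fun B ⟨m, hBm⟩ => ?_⟩
  · have := ae_of_ae_map hΦm.aemeasurable
      (ae_mem_recurrentSet_pastPattern hν (h𝓑.le k) (h𝓑.finite k) (ℓ k))
    filter_upwards [this] with ω hω j
    exact recurrenceSet_nonempty hω _
  · have hB : MeasurableSet B := h𝓑.le m _ hBm
    have hemp := fun k => memLp_empiricalConditional hν (h𝓑.le k) (h𝓑.finite k) (ℓ k) (J k) hB
    simp only [empiricalConditional_eq_coordMap _ X]
    refine ⟨fun k => (hemp k).comp_measurePreserving hΦ, ?_⟩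
    refine (tendsto_empiricalConditional_coordMap hν h𝓑 hJ_pos hℓ_mono hℓ hJ hB).congr
      fun k => ?_
    -- The path map pulls the canonical past back to the past of `X`, so the two conditional
    -- expectations correspond.
    have hσ : (pastSigma (coordMap S)).comap Φ = pastSigma X := by
      simp only [pastSigma, MeasurableSpace.comap_iSup, MeasurableSpace.comap_comp]
      rfl
    have hf : Integrable ((coordMap S 0 ⁻¹' B).indicator fun _ => (1 : ℝ)) ν :=
      (integrable_const _).indicator (measurable_pi_apply 0 hB)
    have hcond := condExp_comp_measurePreserving pastSigma_le hΦ hf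
    rw [hσ] at hcond
    refine (eLpNorm_comp_measurePreserving ((hemp k).aestronglyMeasurable.sub
      integrable_condExp.aestronglyMeasurable) hΦ).symm.trans ?_
    refine eLpNorm_congr_ae ?_
    filter_upwards [hcond] with ω hω
    exact congrArg (_ - ·) hω
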